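/- **Setting.** Let $E$ be a finite set and let $X=(X_t)_{t\ge0}$ be a time-homogeneous, right-continuous, continuous-time Markov chain with values in $E$, with probability measures $(\mathbb P_x)_{x\in E}$ such that $\mathbb P_x(X_0=x)=1$, and with Markov generator $\mathcal Q=(Q(x,y))_{x,y\in E}$. For $f\in\mathbb R^E$ write $\mathcal Q[f](x)=\sum_{y\in E}Q(x,y)f(y)$. Let $\beta>0$ and let $\psi,\phi\in\mathbb R^E$ satisfy $0\le\psi\le\phi$. Stopping times take values in $[0,\infty]$ and are taken with respect to the natural filtration of $X$; for a stopping time $\eta$ put $e^{-\beta\eta}f(X_\eta)=0$ on $\{\eta=\infty\}$. For $A\subset E$ let $h(A)=\inf\{t\ge0: X_t\in A\}$, and for stopping times $\tau,\gamma$ let $$R_x(\tau,\gamma)=\mathbb E_x\big[e^{-\beta\tau}\psi(X_\tau)\mathbf 1_{\tau\le\gamma}+e^{-\beta\gamma}\phi(X_\gamma)\mathbf 1_{\tau>\gamma}\big].$$ Let $V_0(x)=\sup_\tau\mathbb E_x[e^{-\beta\tau}\psi(X_\tau)]$, the supremum being over all stopping times. Define recursively, for $k\ge1$, $$S_1=\{V_0>\phi\}\cup\{\phi=\psi\},\qquad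 S_{k+1}=\big(S_k\cap\{\mathcal Q[V_k]-\beta V_k\ge0\}\big)\cup\{\phi=\psi\},\qquad V_k(x)=\sup_\tau R_x(\tau,h(S_k)).$$ For each $k\ge1$ let $D_k=\bigcap_{n\ge1}D_k^{(n)}$, where $$D_k^{(1)}=\{\mathcal Q[\psi]-\beta\psi\le0\}\setminus S_k,\qquad V_k^{(n)}(x)=R_x\big(h(D_k^{(n)}),h(S_k)\big),\qquad D_k^{(n+1)}=\{\mathcal Q[V_k^{(n)}]-\beta V_k^{(n)}\le0\}\cap D_k^{(n)}.$$ **Theorem.** For every $k\ge1$: 1. $V_k(x)=R_x(h(D_k),h(S_k))$ for all $x\in E$; 2. $D_k\cap S_k=\emptyset$, $V_k=\psi$ on $D_k$, $V_k=\phi$ on $S_k$, and $V_k>\psi$ outside $D_k\cup S_k$; 3. $\mathcal Q[V_k]-\beta V_k\le0$ on $D_k$, and $\mathcal Q[V_k]-\beta V_k=0$ outside $D_k\cup S_k$; 4. $\psi\le V_{k+1}\le V_k\le\phi$. Moreover, 5. the sequence $(D_k)_{k\ge1}$ is increasing and the sequence $(S_k)_{k\ge1}$ is decreasing (with respect to inclusion).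 -/

import Mathlib

open MeasureTheory ProbabilityTheory Filter Topology
open scoped NNReal Matrix

noncomputable section

/-- A Markov generator on a finite set: the rows sum to zero and the off-diagonal entries are
nonnegative. -/
structure IsMarkovGenerator {E : Type*} [Fintype E] (Q : Matrix E E ℝ) : Prop where
  row_sum : ∀ x, ∑ y, Q x y = 0
  offDiag_nonneg : ∀ x y, x ≠ y → 0 ≤ Q x y

/-- The natural filtration `ℱ t = σ(X s, s ≤ t)` of a process with values in a finite discrete
space. -/
def naturalFiltration {E Ω : Type*} [Fintype E] [TopologicalSpace E] [DiscreteTopology E]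
    [MeasurableSpace E] [BorelSpace E] [MeasurableSpace Ω]
    (X : ℝ≥0 → Ω → E) (hX : ∀ t, Measurable (X t)) : Filtration ℝ≥0 ‹MeasurableSpace Ω› :=
  Filtration.natural X fun t => (hX t).stronglyMeasurable

/-- A time-homogeneous, right-continuous, continuous-time Markov chain `X` with values in the
finite discrete space `E`, with the family `(P x)` of laws (`P x` being the law under which the
chain starts from `x`) and with Markov generator `Q`. -/
structure FiniteMarkovChain {E : Type*} [Fintype E] [TopologicalSpace E] [DiscreteTopology E]
    [MeasurableSpace E] [BorelSpace E] (Q : Matrix E E ℝ) (Ω : Type*) [MeasurableSpace Ω] where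
  /-- the process -/
  X : ℝ≥0 → Ω → E
  /-- the probability measures, indexed by the initial state -/
  P : E → Measure Ω
  isProb : ∀ x, IsProbabilityMeasure (P x)
  measurable_X : ∀ t, Measurable (X t)
  rightCont : ∀ ω t, ContinuousWithinAt (fun s => X s ω) (Set.Ici t) t
  start : ∀ x, ∀ᵐ ω ∂(P x), X 0 ω = x
  /-- The Markov property: given the past up to time `s`, the law of `X (s + t)` is the law of
  `X t` for the chain started from `X s`. -/
  markov : ∀ (x : E) (s t : ℝ≥0) (y : E),
    (P x)⟦X (s + t) ⁻¹' {y} | naturalFiltration X measurable_X s⟧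
      =ᵐ[P x] fun ω => (P (X s ω)).real (X t ⁻¹' {y})
  isGenerator : IsMarkovGenerator Q
  /-- `Q` is the derivative at time zero of the transition probabilities. -/
  generator : ∀ x y : E,
    Tendsto (fun t : ℝ≥0 =>
      ((P x).real (X t ⁻¹' {y}) - (P x).real (X 0 ⁻¹' {y})) / (t : ℝ)) (𝓝[>] 0) (𝓝 (Q x y))

/-- The function `𝒬[f] - β f`. -/
def discountedGenerator {E : Type*} [Fintype E] (Q : Matrix E E ℝ) (β : ℝ) (f : E → ℝ) (x : E) :
    ℝ :=
  (Q *ᵥ f) x - β * f x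

namespace FiniteMarkovChain

variable {E : Type*} [Fintype E] [TopologicalSpace E] [DiscreteTopology E]
  [MeasurableSpace E] [BorelSpace E] {Q : Matrix E E ℝ} {Ω : Type*} [MeasurableSpace Ω]

/-- The natural filtration of the chain. -/
def filtration (M : FiniteMarkovChain Q Ω) : Filtration ℝ≥0 ‹MeasurableSpace Ω› :=
  naturalFiltration M.X M.measurable_X

/-- The set of all stopping times, with values in `[0, ∞]`, of the natural filtration. -/
abbrev StoppingTime (M : FiniteMarkovChain Q Ω) : Type _ :=
  {τ : Ω → WithTop ℝ≥0 // IsStoppingTime M.filtration τ}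

/-- The first hitting time `h(A) = inf {t ≥ 0 : X t ∈ A}`, equal to `∞` if `A` is never hit. -/
def hit (M : FiniteMarkovChain Q Ω) (A : Set E) : Ω → WithTop ℝ≥0 :=
  hittingAfter M.X A 0

open Classical in
/-- The discounted reward `e^{-β η} f(X_η)`, equal to zero where `η = ∞`. -/
def discounted (M : FiniteMarkovChain Q Ω) (β : ℝ) (f : E → ℝ) (η : Ω → WithTop ℝ≥0) (ω : Ω) :
    ℝ :=
  if η ω = ⊤ then 0
  else Real.exp (-β * ((η ω).untopD 0 : ℝ≥0)) * f (M.X ((η ω).untopD 0) ω)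

open Classical in
/-- The expected payoff
`R_x(τ, γ) = 𝔼_x[e^{-β τ} ψ(X_τ) 1_{τ ≤ γ} + e^{-β γ} φ(X_γ) 1_{τ > γ}]`. -/
def payoff (M : FiniteMarkovChain Q Ω) (β : ℝ) (ψ φ : E → ℝ) (τ γ : Ω → WithTop ℝ≥0) (x : E) :
    ℝ :=
  ∫ ω, (if τ ω ≤ γ ω then M.discounted β ψ τ ω else M.discounted β φ γ ω) ∂(M.P x)

/-- The value of the one-player stopping problem,
`V₀(x) = sup_τ 𝔼_x[e^{-β τ} ψ(X_τ)]`. -/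
def onePlayerValue (M : FiniteMarkovChain Q Ω) (β : ℝ) (ψ : E → ℝ) (x : E) : ℝ :=
  ⨆ τ : M.StoppingTime, ∫ ω, M.discounted β ψ τ.1 ω ∂(M.P x)

/-- The best payoff `x ↦ sup_τ R_x(τ, h(S))` of the sup-player against the hitting time of `S`. -/
def valueAgainst (M : FiniteMarkovChain Q Ω) (β : ℝ) (ψ φ : E → ℝ) (S : Set E) (x : E) : ℝ :=
  ⨆ τ : M.StoppingTime, M.payoff β ψ φ τ.1 (M.hit S) x

/-- The forward algorithm of the sup-player against the hitting time of `S`. The sequence of sets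
is `D⁽¹⁾, D⁽²⁾, …` (indexed from `0` here): `D⁽¹⁾ = {𝒬[ψ] - β ψ ≤ 0} ∩ Sᶜ` and
`D⁽ⁿ⁺¹⁾ = {𝒬[V⁽ⁿ⁾] - β V⁽ⁿ⁾ ≤ 0} ∩ D⁽ⁿ⁾`, where `V⁽ⁿ⁾(x) = R_x(h(D⁽ⁿ⁾), h(S))`. -/
def forwardSet (M : FiniteMarkovChain Q Ω) (β : ℝ) (ψ φ : E → ℝ) (S : Set E) : ℕ → Set E
  | 0 => {x | discountedGenerator Q β ψ x ≤ 0} ∩ Sᶜ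
  | n + 1 =>
    {x | discountedGenerator Q β
        (M.payoff β ψ φ (M.hit (M.forwardSet β ψ φ S n)) (M.hit S)) x ≤ 0}
      ∩ M.forwardSet β ψ φ S n

/-- The set produced by the forward algorithm against the hitting time of `S`, `⋂ₙ D⁽ⁿ⁾`. -/
def forwardLimit (M : FiniteMarkovChain Q Ω) (β : ℝ) (ψ φ : E → ℝ) (S : Set E) : Set E :=
  ⋂ n, M.forwardSet β ψ φ S n

/-- The stopping sets `S₁, S₂, …` of the inf-player, indexed from `0`: `infSet k` is `S_{k+1}`.
Here `S₁ = {V₀ > φ} ∪ {φ = ψ}` and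
`S_{k+1} = (S_k ∩ {𝒬[V_k] - β V_k ≥ 0}) ∪ {φ = ψ}` with `V_k(x) = sup_τ R_x(τ, h(S_k))`. -/
def infSet (M : FiniteMarkovChain Q Ω) (β : ℝ) (ψ φ : E → ℝ) : ℕ → Set E
  | 0 => {x | φ x < M.onePlayerValue β ψ x} ∪ {x | φ x = ψ x}
  | k + 1 =>
    (M.infSet β ψ φ k ∩
        {x | 0 ≤ discountedGenerator Q β (M.valueAgainst β ψ φ (M.infSet β ψ φ k)) x})
      ∪ {x | φ x = ψ x}

/-- The functions `V₁, V₂, …`, indexed from `0`: `value k` is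
`V_{k+1}(x) = sup_τ R_x(τ, h(S_{k+1}))`. -/
def value (M : FiniteMarkovChain Q Ω) (β : ℝ) (ψ φ : E → ℝ) (k : ℕ) : E → ℝ :=
  M.valueAgainst β ψ φ (M.infSet β ψ φ k)

/-- The stopping sets `D₁, D₂, …` of the sup-player, indexed from `0`: `supSet k` is `D_{k+1}`,
the output of the forward algorithm against the hitting time of `S_{k+1}`. -/
def supSet (M : FiniteMarkovChain Q Ω) (β : ℝ) (ψ φ : E → ℝ) (k : ℕ) : Set E :=
  M.forwardLimit β ψ φ (M.infSet β ψ φ k)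

end FiniteMarkovChain

end

noncomputable section

/-! The probability is confined to one fact, optional stopping in the form `integral_discounted_le`;
the rest is the minimum principle for `𝒬 - β` on a finite set. If `v` dominates `ψ` everywhere and
`φ` on `S`, and `𝒬[v] - β v ≤ 0` off `S`, then `v` bounds every payoff against `h(S)`. For disjoint
`A` and `S`, the payoff of `h(A)` against `h(S)` solves the Dirichlet problem with data `ψ` on `A`
and `φ` on `S` (`payoff_hit_hit_spec`).

The forward algorithm starts from the points where `ψ` is a supersolution and discards points where
stopping leaves the generator positive. By comparison the payoffs increase and exceed `ψ` strictly
wherever a point has been discarded. Finiteness of `E` forces stabilisation, and the final payoff is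
itself a dominating supersolution, hence equals `sup_τ R_x(τ, h(S))` (`forwardLimit_spec`).

For the outer recursion, a point leaves `S_k` only where `𝒬[V_k] - β V_k < 0`, so `V_k` is a
dominating supersolution for the problem against `S_{k+1}`. Thus the values decrease
(`value_succ_le`); the bound by `φ` comes from the first step, by comparison with `V₀`, and the
growth of `D_k` follows from the strict inequality off the stopping sets. -/

lemma exists_forall_norm_le {E : Type*} [Finite E] (v : E → ℝ) :
    ∃ C, ∀ y, ‖v y‖ ≤ C := by
  obtain ⟨C, hC⟩ := (Set.finite_range fun y => ‖v y‖).bddAbove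
  exact ⟨C, fun y => hC ⟨y, rfl⟩⟩

/-! ### Minimum principle and Dirichlet problem for `𝒬 - β`. -/

section MaximumPrinciple

variable {E : Type*} [Fintype E] {Q : Matrix E E ℝ} {β : ℝ}

lemma discountedGenerator_sub (Q : Matrix E E ℝ) (β : ℝ) (f g : E → ℝ) (x : E) :
    discountedGenerator Q β (f - g) x =
      discountedGenerator Q β f x - discountedGenerator Q β g x := by
  simp only [discountedGenerator, Matrix.mulVec_sub, Pi.sub_apply]
  ring

lemma discountedGenerator_neg (Q : Matrix E E ℝ) (β : ℝ) (f : E → ℝ) (x : E) :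
    discountedGenerator Q β (-f) x = -discountedGenerator Q β f x := by
  simp only [discountedGenerator, Matrix.mulVec_neg, Pi.neg_apply]
  ring

lemma IsMarkovGenerator.mulVec_eq (hQ : IsMarkovGenerator Q) (f : E → ℝ) (x : E) :
    (Q *ᵥ f) x = ∑ y, Q x y * (f y - f x) := by
  simp only [mul_sub, Finset.sum_sub_distrib, ← Finset.sum_mul, hQ.row_sum]
  simp [Matrix.mulVec, dotProduct]

lemma IsMarkovGenerator.mulVec_nonneg_of_isMin (hQ : IsMarkovGenerator Q) {f : E → ℝ} {x : E}
    (hx : ∀ y, f x ≤ f y) : 0 ≤ (Q *ᵥ f) x := by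
  rw [hQ.mulVec_eq]
  refine Finset.sum_nonneg fun y _ => ?_
  rcases eq_or_ne x y with rfl | hxy
  · simp
  · exact mul_nonneg (hQ.offDiag_nonneg x y hxy) (sub_nonneg.2 (hx y))

/-- Minimum principle: a function which is nonnegative on `B` and a supersolution off `B` is
nonnegative. -/
lemma IsMarkovGenerator.nonneg_of_supersolution (hQ : IsMarkovGenerator Q) (hβ : 0 < β) {B : Set E}
    {w : E → ℝ} (hB : ∀ x ∈ B, 0 ≤ w x) (hw : ∀ x ∉ B, discountedGenerator Q β w x ≤ 0) (x : E) :
    0 ≤ w x := by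
  have : Nonempty E := ⟨x⟩
  obtain ⟨z, hz⟩ := Finite.exists_min w
  refine le_trans ?_ (hz x)
  by_contra! hneg
  have h1 := hw z fun h => (hB z h).not_gt hneg
  have h2 := hQ.mulVec_nonneg_of_isMin hz
  unfold discountedGenerator at h1
  nlinarith

/-- Strong form of the minimum principle at points where the inequality is strict. -/
lemma IsMarkovGenerator.pos_of_strict_supersolution (hQ : IsMarkovGenerator Q) {w : E → ℝ}
    (hw : ∀ x, 0 ≤ w x) {x : E} (hx : discountedGenerator Q β w x < 0) : 0 < w x := by
  refine (hw x).lt_of_ne fun h0 => ?_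
  have h := hQ.mulVec_nonneg_of_isMin (f := w) (x := x) fun y => h0 ▸ hw y
  unfold discountedGenerator at hx
  rw [← h0] at hx
  linarith

/-- The Dirichlet problem for `𝒬 - β` with boundary `B` is solvable. -/
lemma IsMarkovGenerator.exists_dirichlet (hQ : IsMarkovGenerator Q) (hβ : 0 < β) (B : Set E)
    (g : E → ℝ) :
    ∃ w : E → ℝ, (∀ x ∈ B, w x = g x) ∧ ∀ x ∉ B, discountedGenerator Q β w x = 0 := by
  classical
  let L : (E → ℝ) →ₗ[ℝ] (E → ℝ) :=
    { toFun := fun w x => if x ∈ B then w x else discountedGenerator Q β w x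
      map_add' := fun f g => by
        ext x
        simp only [discountedGenerator, Matrix.mulVec_add, Pi.add_apply]
        split_ifs <;> ring
      map_smul' := fun c f => by
        ext x
        simp only [discountedGenerator, Matrix.mulVec_smul, Pi.smul_apply, smul_eq_mul,
          RingHom.id_apply]
        split_ifs <;> ring }
  have hL : ∀ w x, L w x = if x ∈ B then w x else discountedGenerator Q β w x := fun _ _ => rfl
  -- Uniqueness gives existence: the minimum principle applied to `w` and `-w` kills the kernel, and
  -- an injective endomorphism in finite dimension is onto.
  have hinj : Function.Injective L := by
    rw [← LinearMap.ker_eq_bot, LinearMap.ker_eq_bot']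
    intro w hw
    have hB : ∀ x ∈ B, w x = 0 := fun x hx => by simpa [hL, hx] using congrFun hw x
    have hB' : ∀ x ∉ B, discountedGenerator Q β w x = 0 := fun x hx => by
      simpa [hL, hx] using congrFun hw x
    ext x
    refine le_antisymm ?_ ?_
    · have := hQ.nonneg_of_supersolution hβ (B := B) (w := -w) (fun x hx => by simp [hB x hx])
        (fun x hx => by simp [discountedGenerator_neg, hB' x hx]) x
      simpa using this
    · exact hQ.nonneg_of_supersolution hβ (fun x hx => (hB x hx).ge) (fun x hx => (hB' x hx).le) x
  obtain ⟨w, hw⟩ := LinearMap.injective_iff_surjective.1 hinj (fun x => if x ∈ B then g x else 0)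
  refine ⟨w, fun x hx => ?_, fun x hx => ?_⟩
  · simpa [hL, hx] using congrFun hw x
  · simpa [hL, hx] using congrFun hw x

end MaximumPrinciple

namespace FiniteMarkovChain

variable {E : Type*} [Fintype E] [TopologicalSpace E] [DiscreteTopology E]
  [MeasurableSpace E] [BorelSpace E] {Q : Matrix E E ℝ} {Ω : Type*} [MeasurableSpace Ω]
  (M : FiniteMarkovChain Q Ω) {β : ℝ} {ψ φ : E → ℝ}

/-! ### Hitting times of a right-continuous process in a discrete space. -/

section HittingTimes

lemma eventually_X_eq (ω : Ω) (t : ℝ≥0) : ∀ᶠ s in 𝓝[≥] t, M.X s ω = M.X t ω := by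
  have h := M.rightCont ω t
  rw [ContinuousWithinAt, nhds_discrete, tendsto_pure] at h
  exact h

lemma exists_X_eq_on_Ico (ω : Ω) (t : ℝ≥0) :
    ∃ u > t, ∀ s ∈ Set.Ico t u, M.X s ω = M.X t ω := by
  obtain ⟨u, hu, hsub⟩ := mem_nhdsGE_iff_exists_Ico_subset.1 (M.eventually_X_eq ω t)
  exact ⟨u, hu, fun s hs => hsub hs⟩

lemma hit_le_of_mem {A : Set E} {ω : Ω} {t : ℝ≥0} (h : M.X t ω ∈ A) : M.hit A ω ≤ t :=
  hittingAfter_le_of_mem zero_le h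

/-- The infimum is attained: the path is constant on some `[t, u)`, and it visits `A` during that
interval. -/
lemma X_mem_of_hit_eq {A : Set E} {ω : Ω} {t : ℝ≥0} (h : M.hit A ω = t) : M.X t ω ∈ A := by
  obtain ⟨u, hu, hX⟩ := M.exists_X_eq_on_Ico ω t
  have hlt : hittingAfter M.X A 0 ω < (u : WithTop ℝ≥0) := by
    change M.hit A ω < _
    rw [h]
    exact_mod_cast hu
  obtain ⟨j, hj, hjA⟩ := hittingAfter_lt_iff.1 hlt
  have htj : t ≤ j := by
    have := M.hit_le_of_mem hjA
    rw [h] at this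
    exact_mod_cast this
  rwa [← hX j ⟨htj, hj.2⟩]

lemma X_notMem_of_lt_hit {A : Set E} {ω : Ω} {t : ℝ≥0} (h : (t : WithTop ℝ≥0) < M.hit A ω) :
    M.X t ω ∉ A :=
  notMem_of_lt_hittingAfter h zero_le

lemma hit_union (A S : Set E) (ω : Ω) : M.hit (A ∪ S) ω = min (M.hit A ω) (M.hit S ω) := by
  refine le_antisymm (le_min (hittingAfter_apply_anti _ _ _ Set.subset_union_left)
    (hittingAfter_apply_anti _ _ _ Set.subset_union_right)) ?_
  rcases h : M.hit (A ∪ S) ω with _ | t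
  · exact le_top
  · rcases M.X_mem_of_hit_eq h with hA | hS
    · exact (min_le_left _ _).trans (M.hit_le_of_mem hA)
    · exact (min_le_right _ _).trans (M.hit_le_of_mem hS)

lemma measurableSet_X_preimage {s t : ℝ≥0} (hst : s ≤ t) (A : Set E) :
    MeasurableSet[M.filtration t] (M.X s ⁻¹' A) := by
  refine M.filtration.mono hst _ ?_
  exact (Filtration.stronglyAdapted_natural
    fun t => (M.measurable_X t).stronglyMeasurable) s |>.measurable A.toFinite.measurableSet

/-- Right-constancy reduces a visit to `A` strictly before `i` to a visit at one of countably many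
dense times; time `i` is added separately, so the filtration need not be right-continuous. -/
lemma isStoppingTime_hit (A : Set E) : IsStoppingTime M.filtration (M.hit A) := by
  intro i
  have hset : {ω | M.hit A ω ≤ i} = M.X i ⁻¹' A ∪
      ⋃ n, ⋃ _ : TopologicalSpace.denseSeq ℝ≥0 n ≤ i,
        M.X (TopologicalSpace.denseSeq ℝ≥0 n) ⁻¹' A := by
    ext ω
    simp only [Set.mem_ofPred_eq, Set.mem_union, Set.mem_preimage, Set.mem_iUnion, exists_prop]
    constructor
    · intro h
      obtain ⟨t, ht⟩ := WithTop.ne_top_iff_exists.1 (ne_top_of_le_ne_top WithTop.coe_ne_top h)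
      have hX := M.X_mem_of_hit_eq ht.symm
      rw [← ht] at h
      have hti : t ≤ i := by exact_mod_cast h
      rcases hti.eq_or_lt with rfl | hti
      · exact Or.inl hX
      obtain ⟨u, hu, hconst⟩ := M.exists_X_eq_on_Ico ω t
      obtain ⟨s, ⟨n, rfl⟩, hs⟩ := (TopologicalSpace.denseRange_denseSeq ℝ≥0).exists_between
        (lt_min hu hti)
      refine Or.inr ⟨n, (hs.2.trans_le (min_le_right _ _)).le, ?_⟩
      rwa [hconst _ ⟨hs.1.le, hs.2.trans_le (min_le_left _ _)⟩]
    · rintro (h | ⟨n, hn, h⟩)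
      · exact M.hit_le_of_mem h
      · exact (M.hit_le_of_mem h).trans (by exact_mod_cast hn)
  rw [hset]
  exact (M.measurableSet_X_preimage le_rfl A).union <| MeasurableSet.iUnion fun n =>
    MeasurableSet.iUnion fun hn => M.measurableSet_X_preimage hn A

end HittingTimes

/-! ### Transition operators and their derivative at time zero. -/

section Transition

/-- The transition operator `v ↦ 𝔼_x[v(X_t)]`. -/
def transition (t : ℝ≥0) (v : E → ℝ) (x : E) : ℝ :=
  ∑ y, (M.P x).real (M.X t ⁻¹' {y}) * v y

lemma measurable_comp_X (v : E → ℝ) (t : ℝ≥0) : Measurable fun ω => v (M.X t ω) :=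
  (measurable_of_finite v).comp (M.measurable_X t)

lemma integrable_comp_X (v : E → ℝ) (t : ℝ≥0) (x : E) :
    Integrable (fun ω => v (M.X t ω)) (M.P x) := by
  have := M.isProb x
  obtain ⟨C, hC⟩ := exists_forall_norm_le v
  exact Integrable.of_bound (M.measurable_comp_X v t).aestronglyMeasurable C
    (ae_of_all _ fun ω => hC _)

/-- The Markov property in integrated form. -/
lemma setIntegral_comp_X_add (v : E → ℝ) (s t : ℝ≥0) (x : E) {A : Set Ω}
    (hA : MeasurableSet[M.filtration s] A) :
    ∫ ω in A, v (M.X (s + t) ω) ∂(M.P x) = ∫ ω in A, M.transition t v (M.X s ω) ∂(M.P x) := by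
  classical
  have := M.isProb x
  have hA' := M.filtration.le s A hA
  have hy : ∀ y, ∫ ω in A, (M.X (s + t) ⁻¹' {y}).indicator (fun _ => (1 : ℝ)) ω ∂(M.P x) =
      ∫ ω in A, (M.P (M.X s ω)).real (M.X t ⁻¹' {y}) ∂(M.P x) := fun y => by
    rw [← setIntegral_condExp (M.filtration.le s) _ hA]
    · exact setIntegral_congr_ae hA' ((M.markov x s t y).mono fun ω h _ => h)
    · exact (integrable_const 1).indicator (M.measurable_X _ (measurableSet_singleton y))
  have hv : ∀ ω, v (M.X (s + t) ω) =
      ∑ y, (M.X (s + t) ⁻¹' {y}).indicator (fun _ => (1 : ℝ)) ω * v y := fun ω => by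
    simp [Set.indicator_apply]
  simp only [hv, transition]
  rw [integral_finsetSum _ fun y _ => ?_, integral_finsetSum _ fun y _ => ?_]
  · simp only [integral_mul_const, hy]
  · exact ((M.integrable_comp_X (fun z => (M.P z).real (M.X t ⁻¹' {y})) s x).mul_const
      _).integrableOn
  · exact (((integrable_const 1).indicator
      (M.measurable_X _ (measurableSet_singleton y))).mul_const _).integrableOn

lemma transition_zero (v : E → ℝ) (x : E) : M.transition 0 v x = v x := by
  classical
  have := M.isProb x
  have h : ∀ y, (M.P x).real (M.X 0 ⁻¹' {y}) = if y = x then 1 else 0 := fun y => by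
    split_ifs with hy
    · rw [← probReal_univ (μ := M.P x)]
      exact measureReal_congr ((M.start x).mono fun ω h =>
        propext ⟨fun _ => trivial, fun _ => h.trans hy.symm⟩)
    · rw [← measureReal_empty (μ := M.P x)]
      exact measureReal_congr ((M.start x).mono fun ω h =>
        propext ⟨fun h' => hy (Eq.trans (Eq.symm h') h), False.elim⟩)
  simp [transition, h]

lemma tendsto_discounted_transition (β : ℝ) (v : E → ℝ) (x : E) :
    Tendsto (fun t : ℝ≥0 => (Real.exp (-β * t) * M.transition t v x - v x) / (t : ℝ)) (𝓝[>] 0)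
      (𝓝 (discountedGenerator Q β v x)) := by
  have hT : Tendsto (fun t : ℝ≥0 => (M.transition t v x - v x) / (t : ℝ)) (𝓝[>] 0)
      (𝓝 ((Q *ᵥ v) x)) := by
    have h := tendsto_finsetSum Finset.univ fun y _ => (M.generator x y).mul_const (v y)
    refine h.congr fun t => ?_
    rw [← M.transition_zero v x, transition, transition, ← Finset.sum_sub_distrib, Finset.sum_div]
    exact Finset.sum_congr rfl fun y _ => by ring
  have hcoe : Tendsto (fun t : ℝ≥0 => (t : ℝ)) (𝓝[>] 0) (𝓝[≠] 0) := by
    refine tendsto_nhdsWithin_iff.2 ⟨?_, eventually_mem_nhdsWithin.mono fun t ht => ?_⟩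
    · exact (NNReal.continuous_coe.tendsto' 0 0 rfl).mono_left nhdsWithin_le_nhds
    · exact (NNReal.coe_pos.2 ht).ne'
  have hexp : Tendsto (fun t : ℝ≥0 => (Real.exp (-β * t) - 1) / (t : ℝ)) (𝓝[>] 0) (𝓝 (-β)) := by
    have hd : HasDerivAt (fun t : ℝ => Real.exp (-β * t)) (-β) 0 := by
      simpa using ((hasDerivAt_id (0 : ℝ)).const_mul (-β)).exp
    refine ((hasDerivAt_iff_tendsto_slope.1 hd).comp hcoe).congr fun t => ?_
    simp [slope_def_field]
  have hone : Tendsto (fun t : ℝ≥0 => Real.exp (-β * t)) (𝓝[>] 0) (𝓝 1) := by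
    have : Continuous fun t : ℝ≥0 => Real.exp (-β * t) := by fun_prop
    exact (this.tendsto' 0 1 (by simp)).mono_left nhdsWithin_le_nhds
  have h := (hone.mul hT).add (hexp.mul_const (v x))
  rw [show 1 * (Q *ᵥ v) x + -β * v x = discountedGenerator Q β v x by
    rw [discountedGenerator]; ring] at h
  refine h.congr fun t => ?_
  ring

end Transition

/-! ### Optional stopping by discretisation in time. -/

section Dynkin

/-- The number of steps on the grid of mesh `1 / (n + 1)`, among the first `j`, which start before
the time `θ`. -/
def gridIndex (θ : WithTop ℝ≥0) (n j : ℕ) : ℕ :=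
  if θ = ⊤ then j else min j ⌈θ.untopD 0 * (n + 1)⌉₊

/-- The `j`-th point of the grid of mesh `1 / (n + 1)`. -/
def gridPoint (n j : ℕ) : ℝ≥0 := j / (n + 1)

lemma gridPoint_succ (n j : ℕ) : gridPoint n (j + 1) = gridPoint n j + gridPoint n 1 := by
  simp only [gridPoint, ← add_div]
  push_cast
  rfl

lemma gridIndex_of_lt {θ : WithTop ℝ≥0} {n j : ℕ} (h : (gridPoint n j : WithTop ℝ≥0) < θ) :
    gridIndex θ n j = j ∧ gridIndex θ n (j + 1) = j + 1 := by
  induction θ with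
  | top => simp [gridIndex]
  | coe r =>
    have h' : (j : ℝ≥0) < r * (n + 1) := by
      rw [← div_lt_iff₀ (by positivity)]
      exact WithTop.coe_lt_coe.1 h
    have := Nat.lt_ceil.2 h'
    simp only [gridIndex, WithTop.coe_ne_top, if_false, WithTop.untopD_coe]
    omega

lemma gridIndex_of_not_lt {θ : WithTop ℝ≥0} {n j : ℕ}
    (h : ¬ (gridPoint n j : WithTop ℝ≥0) < θ) : gridIndex θ n (j + 1) = gridIndex θ n j := by
  induction θ with
  | top => exact absurd (WithTop.coe_lt_top _) h
  | coe r =>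
    have h' : ¬ (j : ℝ≥0) < r * (n + 1) := by
      rw [← div_lt_iff₀ (by positivity)]
      exact fun h' => h (WithTop.coe_lt_coe.2 h')
    have := mt Nat.lt_ceil.1 h'
    simp only [gridIndex, WithTop.coe_ne_top, if_false, WithTop.untopD_coe]
    omega

/-- The discounted process on the grid of mesh `1 / (n + 1)`, stopped at the first grid point after
`θ`. -/
def gridValue (β : ℝ) (v : E → ℝ) (θ : Ω → WithTop ℝ≥0) (n j : ℕ) (ω : Ω) : ℝ :=
  Real.exp (-β * gridPoint n (gridIndex (θ ω) n j)) *
    v (M.X (gridPoint n (gridIndex (θ ω) n j)) ω)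

lemma gridValue_zero (β : ℝ) (v : E → ℝ) (θ : Ω → WithTop ℝ≥0) (n : ℕ) (ω : Ω) :
    M.gridValue β v θ n 0 ω = v (M.X 0 ω) := by
  have : gridIndex (θ ω) n 0 = 0 := by simp [gridIndex]
  simp [gridValue, this, gridPoint]

/-- The increment lives on an event known at the current grid time, which is what makes the Markov
property applicable to it. -/
lemma gridValue_succ (β : ℝ) (v : E → ℝ) (θ : Ω → WithTop ℝ≥0) (n j : ℕ) (ω : Ω) :
    M.gridValue β v θ n (j + 1) ω = M.gridValue β v θ n j ω +
      {ω | (gridPoint n j : WithTop ℝ≥0) < θ ω}.indicator (fun ω =>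
        Real.exp (-β * gridPoint n j) * (Real.exp (-β * gridPoint n 1) *
          v (M.X (gridPoint n j + gridPoint n 1) ω) - v (M.X (gridPoint n j) ω))) ω := by
  by_cases h : (gridPoint n j : WithTop ℝ≥0) < θ ω
  · rw [Set.indicator_of_mem (by exact h), gridValue, gridValue, (gridIndex_of_lt h).1,
      (gridIndex_of_lt h).2, gridPoint_succ, NNReal.coe_add, mul_add, Real.exp_add]
    ring
  · rw [Set.indicator_of_notMem (by exact h), gridValue, gridValue, gridIndex_of_not_lt h,
      add_zero]

lemma measurableSet_lt_stoppingTime {θ : Ω → WithTop ℝ≥0} (hθ : IsStoppingTime M.filtration θ)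
    (t : ℝ≥0) : MeasurableSet[M.filtration t] {ω | (t : WithTop ℝ≥0) < θ ω} := by
  have := (hθ t).compl
  convert this using 1
  ext ω
  exact (not_le (a := θ ω) (b := (t : WithTop ℝ≥0))).symm

lemma measurable_gridValue (β : ℝ) (v : E → ℝ) {θ : Ω → WithTop ℝ≥0}
    (hθ : IsStoppingTime M.filtration θ) (n j : ℕ) : Measurable (M.gridValue β v θ n j) := by
  induction j with
  | zero =>
    rw [show M.gridValue β v θ n 0 = _ from funext (M.gridValue_zero β v θ n)]
    exact M.measurable_comp_X v 0
  | succ j ih =>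
    rw [show M.gridValue β v θ n (j + 1) = _ from funext (M.gridValue_succ β v θ n j)]
    refine ih.add (Measurable.indicator ?_
      (M.filtration.le _ _ (M.measurableSet_lt_stoppingTime hθ _)))
    exact (((M.measurable_comp_X v _).const_mul _).sub (M.measurable_comp_X v _)).const_mul _

lemma norm_gridValue_le (hβ : 0 < β) {v : E → ℝ} {C : ℝ} (hC : ∀ y, ‖v y‖ ≤ C)
    (θ : Ω → WithTop ℝ≥0) (n j : ℕ) (ω : Ω) :
    ‖M.gridValue β v θ n j ω‖ ≤ C := by
  rw [gridValue, norm_mul, Real.norm_eq_abs, Real.abs_exp]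
  refine (mul_le_of_le_one_left (norm_nonneg _) (Real.exp_le_one_iff.2 ?_)).trans (hC _)
  rw [neg_mul]
  exact neg_nonpos.2 (by positivity)

lemma integrable_gridValue (hβ : 0 < β) (v : E → ℝ) {θ : Ω → WithTop ℝ≥0}
    (hθ : IsStoppingTime M.filtration θ) (n j : ℕ) (x : E) :
    Integrable (M.gridValue β v θ n j) (M.P x) := by
  have := M.isProb x
  obtain ⟨C, hC⟩ := exists_forall_norm_le v
  exact Integrable.of_bound (M.measurable_gridValue β v hθ n j).aestronglyMeasurable C
    (ae_of_all _ (M.norm_gridValue_le hβ hC θ n j))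

/-- Supermartingale property on the grid: before `θ` the chain sits in `C`, where one discounted
step does not increase the mean of `v`. -/
lemma integral_gridValue_le (hβ : 0 < β) {v : E → ℝ} {θ : Ω → WithTop ℝ≥0}
    (hθ : IsStoppingTime M.filtration θ) {C : Set E}
    (hC : ∀ ω (t : ℝ≥0), (t : WithTop ℝ≥0) < θ ω → M.X t ω ∈ C) {n : ℕ}
    (hn : ∀ y ∈ C, Real.exp (-β * gridPoint n 1) * M.transition (gridPoint n 1) v y - v y ≤ 0)
    (j : ℕ) (x : E) : ∫ ω, M.gridValue β v θ n j ω ∂(M.P x) ≤ v x := by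
  have := M.isProb x
  induction j with
  | zero =>
    simp only [gridValue_zero]
    rw [integral_congr_ae (g := fun _ => v x) ((M.start x).mono fun ω h => congrArg v h)]
    simp
  | succ j ih =>
    have hA := M.measurableSet_lt_stoppingTime hθ (gridPoint n j)
    have hA' := M.filtration.le _ _ hA
    have hint := (M.integrable_comp_X v (gridPoint n j + gridPoint n 1) x).const_mul
      (Real.exp (-β * gridPoint n 1))
    have hint' := M.integrable_comp_X v (gridPoint n j) x
    simp only [gridValue_succ]
    have hint'' := (((hint.sub hint').const_mul (Real.exp (-β * gridPoint n j))).indicator hA')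
    simp only [Pi.sub_apply] at hint''
    rw [integral_add (M.integrable_gridValue hβ v hθ n j x) hint'',
      integral_indicator hA', integral_const_mul,
      integral_sub hint.integrableOn hint'.integrableOn, integral_const_mul,
      M.setIntegral_comp_X_add v _ _ x hA, ← integral_const_mul, ← integral_sub
      ((M.integrable_comp_X (M.transition (gridPoint n 1) v) _ x).const_mul _).integrableOn
      hint'.integrableOn]
    refine (add_le_of_nonpos_right ?_).trans ih
    refine mul_nonpos_of_nonneg_of_nonpos (Real.exp_nonneg _) ?_
    exact setIntegral_nonpos hA' fun ω hω => hn _ (hC ω _ hω)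

lemma tendsto_gridPoint_one : Tendsto (fun n => gridPoint n 1) atTop (𝓝[>] 0) := by
  refine tendsto_nhdsWithin_iff.2 ⟨?_, .of_forall fun n => ?_⟩
  · simpa [gridPoint] using tendsto_one_div_add_atTop_nhds_zero_nat (𝕜 := ℝ≥0)
  · simp only [gridPoint, Set.mem_Ioi]
    positivity

/-- Grid points approach a finite `θ` from the right, where the path is constant. With `(n + 1) * (n
+ 1)` steps the horizon is time `n + 1`, so on `θ = ∞` the discount drives the value to zero. -/
lemma tendsto_gridValue (hβ : 0 < β) (v : E → ℝ) (θ : Ω → WithTop ℝ≥0) (ω : Ω) :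
    Tendsto (fun n => M.gridValue β v θ n ((n + 1) * (n + 1)) ω) atTop
      (𝓝 (M.discounted β v θ ω)) := by
  have hcast : Tendsto (fun n : ℕ => ((n : ℝ) + 1)) atTop atTop :=
    tendsto_atTop_add_const_right _ _ tendsto_natCast_atTop_atTop
  rcases h : θ ω with _ | r
  · change θ ω = ⊤ at h
    obtain ⟨C, hC⟩ := exists_forall_norm_le v
    rw [discounted, if_pos h]
    have hexp : Tendsto (fun n : ℕ => Real.exp (-β * ((n : ℝ) + 1)) * C) atTop (𝓝 0) := by
      simpa using (Real.tendsto_exp_atBot.comp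
        (hcast.const_mul_atTop_of_neg (neg_neg_of_pos hβ))).mul_const C
    refine squeeze_zero_norm (fun n => ?_) hexp
    have ht : (gridPoint n ((n + 1) * (n + 1)) : ℝ) = n + 1 := by
      simp only [gridPoint]
      push_cast
      field_simp
    have hK : gridIndex (θ ω) n ((n + 1) * (n + 1)) = (n + 1) * (n + 1) := by
      simp [gridIndex, h]
    rw [gridValue, hK, ht, norm_mul, Real.norm_eq_abs, Real.abs_exp]
    gcongr
    exact hC _
  · change θ ω = (r : WithTop ℝ≥0) at h
    have hne : θ ω ≠ ⊤ := h ▸ WithTop.coe_ne_top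
    have hr : (θ ω).untopD 0 = r := by rw [h, WithTop.untopD_coe]
    rw [discounted, if_neg hne, hr]
    have hle : ∀ n : ℕ, r ≤ gridPoint n ⌈r * (n + 1)⌉₊ := fun n => by
      rw [gridPoint, le_div_iff₀ (by positivity)]
      exact Nat.le_ceil _
    have hlim : Tendsto (fun n : ℕ => gridPoint n ⌈r * (n + 1)⌉₊) atTop (𝓝[≥] r) := by
      refine tendsto_nhdsWithin_iff.2 ⟨?_, .of_forall hle⟩
      refine NNReal.tendsto_coe.1 ?_
      refine ((tendsto_nat_ceil_mul_div_atTop r.coe_nonneg).comp hcast).congr fun n => ?_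
      have : ⌈(r : ℝ) * (n + 1)⌉₊ = ⌈r * (n + 1)⌉₊ := by
        rw [show (r : ℝ) * (n + 1) = ((r * (n + 1) : ℝ≥0) : ℝ) by push_cast; rfl]
        exact Nonneg.nat_ceil_coe _
      simp [gridPoint, this]
    have hK : ∀ᶠ n : ℕ in atTop,
        gridIndex (θ ω) n ((n + 1) * (n + 1)) = ⌈r * (n + 1)⌉₊ := by
      -- Once `n ≥ r` the cap on the number of steps is inactive.
      filter_upwards [eventually_ge_atTop ⌈r⌉₊] with n hn
      rw [gridIndex, if_neg hne, hr, min_eq_right]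
      refine Nat.ceil_le.2 ?_
      push_cast
      gcongr
      exact (Nat.ceil_le.1 hn).trans (by simp)
    have hexp : Tendsto (fun n : ℕ => Real.exp (-β * gridPoint n ⌈r * (n + 1)⌉₊)) atTop
        (𝓝 (Real.exp (-β * r))) := by
      have : Continuous fun t : ℝ≥0 => Real.exp (-β * t) := by fun_prop
      exact (this.tendsto r).comp (hlim.mono_right nhdsWithin_le_nhds)
    refine (hexp.mul_const (v (M.X r ω))).congr' ?_
    filter_upwards [hK, hlim.eventually (M.eventually_X_eq ω r)] with n hn hX
    rw [gridValue, hn, hX]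

lemma measurable_discounted (hβ : 0 < β) (v : E → ℝ) {θ : Ω → WithTop ℝ≥0}
    (hθ : IsStoppingTime M.filtration θ) : Measurable (M.discounted β v θ) :=
  measurable_of_tendsto_metrizable (fun n => M.measurable_gridValue β v hθ n _)
    (tendsto_pi_nhds.2 (M.tendsto_gridValue hβ v θ))

lemma norm_discounted_le (hβ : 0 < β) {v : E → ℝ} {C : ℝ} (hC : ∀ y, ‖v y‖ ≤ C)
    (θ : Ω → WithTop ℝ≥0) (ω : Ω) : ‖M.discounted β v θ ω‖ ≤ C :=
  le_of_tendsto (M.tendsto_gridValue hβ v θ ω).norm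
    (.of_forall fun n => M.norm_gridValue_le hβ hC θ n _ ω)

lemma integrable_discounted (hβ : 0 < β) (v : E → ℝ) {θ : Ω → WithTop ℝ≥0}
    (hθ : IsStoppingTime M.filtration θ) (x : E) :
    Integrable (M.discounted β v θ) (M.P x) := by
  have := M.isProb x
  obtain ⟨C, hC⟩ := exists_forall_norm_le v
  exact Integrable.of_bound (M.measurable_discounted hβ v hθ).aestronglyMeasurable C
    (ae_of_all _ (M.norm_discounted_le hβ hC θ))

/-- A strictly negative derivative at time zero makes a short discounted step nonincreasing, for all
`y ∈ C` at once since `E` is finite. A zero derivative would say nothing about the sign of the step.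
-/
lemma integral_discounted_le_of_neg (hβ : 0 < β) {v : E → ℝ} {θ : Ω → WithTop ℝ≥0}
    (hθ : IsStoppingTime M.filtration θ) {C : Set E}
    (hC : ∀ ω (t : ℝ≥0), (t : WithTop ℝ≥0) < θ ω → M.X t ω ∈ C)
    (hv : ∀ y ∈ C, discountedGenerator Q β v y < 0) (x : E) :
    ∫ ω, M.discounted β v θ ω ∂(M.P x) ≤ v x := by
  have := M.isProb x
  obtain ⟨B, hB⟩ := exists_forall_norm_le v
  have hlim : Tendsto (fun n => ∫ ω, M.gridValue β v θ n ((n + 1) * (n + 1)) ω ∂(M.P x)) atTop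
      (𝓝 (∫ ω, M.discounted β v θ ω ∂(M.P x))) :=
    tendsto_integral_of_dominated_convergence (fun _ => B)
      (fun n => (M.measurable_gridValue β v hθ n _).aestronglyMeasurable) (integrable_const B)
      (fun n => ae_of_all _ (M.norm_gridValue_le hβ hB θ n _))
      (ae_of_all _ (M.tendsto_gridValue hβ v θ))
  refine le_of_tendsto hlim ?_
  have hev : ∀ᶠ n in atTop, ∀ y, y ∈ C →
      Real.exp (-β * gridPoint n 1) * M.transition (gridPoint n 1) v y - v y ≤ 0 := by
    refine eventually_all.2 fun y => ?_
    by_cases hy : y ∈ C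
    · have h := ((M.tendsto_discounted_transition β v y).comp tendsto_gridPoint_one).eventually
        (gt_mem_nhds (hv y hy))
      filter_upwards [h] with n hn _
      have hpos : (0 : ℝ) < gridPoint n 1 := by
        simp only [gridPoint]
        positivity
      exact ((div_neg_iff.1 hn).resolve_left fun h => h.2.not_gt hpos).1.le
    · exact .of_forall fun n h => absurd h hy
  filter_upwards [hev] with n hn
  exact M.integral_gridValue_le hβ hθ hC hn _ x

/-- Optional stopping for supersolutions: if `𝒬[v] - β v ≤ 0` on a set in which the chain stays
before the stopping time `θ`, then `𝔼_x[e^{-β θ} v(X_θ)] ≤ v(x)`. -/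
theorem integral_discounted_le (hβ : 0 < β) {v : E → ℝ} {θ : Ω → WithTop ℝ≥0}
    (hθ : IsStoppingTime M.filtration θ) {C : Set E}
    (hC : ∀ ω (t : ℝ≥0), (t : WithTop ℝ≥0) < θ ω → M.X t ω ∈ C)
    (hv : ∀ y ∈ C, discountedGenerator Q β v y ≤ 0) (x : E) :
    ∫ ω, M.discounted β v θ ω ∂(M.P x) ≤ v x := by
  refine le_of_forall_pos_le_add fun η hη => ?_
  -- `𝒬` kills constants, so adding `η` lowers `𝒬[v] - β v` by `β * η` and makes it strictly
  -- negative.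
  have hneg : ∀ y ∈ C, discountedGenerator Q β (fun z => v z + η) y < 0 := fun y hy => by
    have h1 := hv y hy
    have h2 : (0 : ℝ) < β * η := mul_pos hβ hη
    simp only [discountedGenerator, M.isGenerator.mulVec_eq, add_sub_add_right_eq_sub] at h1 ⊢
    linarith
  refine le_trans (integral_mono (M.integrable_discounted hβ v hθ x)
    (M.integrable_discounted hβ _ hθ x) fun ω => ?_)
    (M.integral_discounted_le_of_neg hβ hθ hC hneg x)
  simp only [discounted]
  split_ifs
  · exact le_rfl
  · gcongr
    linarith

end Dynkin

/-! ### Payoffs, supersolutions and the Dirichlet problem. -/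

section Payoff

lemma discounted_of_eq_coe (β : ℝ) (f : E → ℝ) {θ : Ω → WithTop ℝ≥0} {ω : Ω} {t : ℝ≥0}
    (h : θ ω = t) : M.discounted β f θ ω = Real.exp (-β * t) * f (M.X t ω) := by
  rw [discounted, h, if_neg WithTop.coe_ne_top, WithTop.untopD_coe]

lemma discounted_of_eq_top (β : ℝ) (f : E → ℝ) {θ : Ω → WithTop ℝ≥0} {ω : Ω} (h : θ ω = ⊤) :
    M.discounted β f θ ω = 0 := by
  simp [discounted, h]

lemma discounted_congr (β : ℝ) (f : E → ℝ) {θ η : Ω → WithTop ℝ≥0} {ω : Ω} (h : θ ω = η ω) :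
    M.discounted β f θ ω = M.discounted β f η ω := by
  simp [discounted, h]

lemma discounted_mono {f g : E → ℝ} {θ : Ω → WithTop ℝ≥0} {ω : Ω}
    (h : ∀ t : ℝ≥0, θ ω = t → f (M.X t ω) ≤ g (M.X t ω)) :
    M.discounted β f θ ω ≤ M.discounted β g θ ω := by
  rcases hθ : θ ω with _ | t
  · rw [M.discounted_of_eq_top β f hθ, M.discounted_of_eq_top β g hθ]
  · rw [M.discounted_of_eq_coe β f hθ, M.discounted_of_eq_coe β g hθ]
    exact mul_le_mul_of_nonneg_left (h t hθ) (Real.exp_nonneg _)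

lemma discounted_nonneg {f : E → ℝ} (hf : ∀ x, 0 ≤ f x) (θ : Ω → WithTop ℝ≥0) (ω : Ω) :
    0 ≤ M.discounted β f θ ω := by
  rw [discounted]
  split_ifs
  · exact le_rfl
  · exact mul_nonneg (Real.exp_nonneg _) (hf _)

theorem payoff_le_of_supersolution (hβ : 0 < β) (hψ : ∀ x, 0 ≤ ψ x) (hφ : ∀ x, 0 ≤ φ x)
    {S : Set E} {v : E → ℝ} (hψv : ∀ x, ψ x ≤ v x) (hφv : ∀ x ∈ S, φ x ≤ v x)
    (hv : ∀ x ∉ S, discountedGenerator Q β v x ≤ 0) (τ : M.StoppingTime) (x : E) :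
    M.payoff β ψ φ τ.1 (M.hit S) x ≤ v x := by
  have hθ := τ.2.min (M.isStoppingTime_hit S)
  -- Since `ψ` and `φ` are nonnegative, only the dominating integrand has to be integrable.
  refine le_trans (integral_mono_of_nonneg (ae_of_all _ fun ω => ?_)
    (M.integrable_discounted hβ v hθ x) (ae_of_all _ fun ω => ?_))
    (M.integral_discounted_le hβ hθ (C := Sᶜ)
      (fun ω t ht => M.X_notMem_of_lt_hit (ht.trans_le (min_le_right _ _))) hv x)
  · dsimp only
    split_ifs
    · exact M.discounted_nonneg hψ _ ω
    · exact M.discounted_nonneg hφ _ ω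
  · dsimp only
    split_ifs with h
    · rw [M.discounted_congr β v (η := τ.1) (min_eq_left h)]
      exact M.discounted_mono fun t _ => hψv _
    · rw [M.discounted_congr β v (η := M.hit S) (min_eq_right (le_of_not_ge h))]
      exact M.discounted_mono fun t ht => hφv _ (M.X_mem_of_hit_eq ht)

/-- Optional stopping applied to both `w` and `-w`. -/
lemma integral_discounted_hit_eq (hβ : 0 < β) {B : Set E} {w : E → ℝ}
    (hw : ∀ x ∉ B, discountedGenerator Q β w x = 0) (x : E) :
    ∫ ω, M.discounted β w (M.hit B) ω ∂(M.P x) = w x := by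
  have hB : ∀ ω (t : ℝ≥0), (t : WithTop ℝ≥0) < M.hit B ω → M.X t ω ∈ Bᶜ :=
    fun ω t => M.X_notMem_of_lt_hit
  refine le_antisymm (M.integral_discounted_le hβ (M.isStoppingTime_hit B) hB
    (fun y hy => (hw y hy).le) x) ?_
  have h := M.integral_discounted_le hβ (v := -w) (M.isStoppingTime_hit B) hB
    (fun y hy => by simp [discountedGenerator_neg, hw y hy]) x
  have hneg : M.discounted β (-w) (M.hit B) = fun ω => -M.discounted β w (M.hit B) ω := by
    ext ω
    simp only [discounted, Pi.neg_apply]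
    split_ifs <;> simp
  rw [hneg, integral_neg] at h
  exact neg_le_neg_iff.1 h

/-- The payoff of two hitting times of disjoint sets solves the Dirichlet problem with boundary
values `ψ` and `φ`. -/
theorem payoff_hit_hit_spec (hβ : 0 < β) (ψ φ : E → ℝ) {A S : Set E} (hAS : Disjoint A S) :
    (∀ x ∈ A, M.payoff β ψ φ (M.hit A) (M.hit S) x = ψ x) ∧
    (∀ x ∈ S, M.payoff β ψ φ (M.hit A) (M.hit S) x = φ x) ∧
    ∀ x ∉ A ∪ S, discountedGenerator Q β (M.payoff β ψ φ (M.hit A) (M.hit S)) x = 0 := by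
  classical
  obtain ⟨w, hwB, hw⟩ := M.isGenerator.exists_dirichlet hβ (A ∪ S)
    fun x => if x ∈ A then ψ x else φ x
  have hA : ∀ x ∈ A, w x = ψ x := fun x hx => by simpa [hx] using hwB x (Or.inl hx)
  have hS : ∀ x ∈ S, w x = φ x := fun x hx => by
    simpa [Set.disjoint_right.1 hAS hx] using hwB x (Or.inr hx)
  have hp : M.payoff β ψ φ (M.hit A) (M.hit S) = w := by
    ext x
    rw [← M.integral_discounted_hit_eq hβ hw x, payoff]
    refine integral_congr_ae (ae_of_all _ fun ω => ?_)
    dsimp only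
    split_ifs with h
    · rw [M.discounted_congr β w (η := M.hit A) ((M.hit_union A S ω).trans (min_eq_left h))]
      exact le_antisymm (M.discounted_mono fun t ht => (hA _ (M.X_mem_of_hit_eq ht)).ge)
        (M.discounted_mono fun t ht => (hA _ (M.X_mem_of_hit_eq ht)).le)
    · rw [M.discounted_congr β w (η := M.hit S)
        ((M.hit_union A S ω).trans (min_eq_right (le_of_not_ge h)))]
      exact le_antisymm (M.discounted_mono fun t ht => (hS _ (M.X_mem_of_hit_eq ht)).ge)
        (M.discounted_mono fun t ht => (hS _ (M.X_mem_of_hit_eq ht)).le)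
  rw [hp]
  exact ⟨hA, hS, hw⟩

end Payoff

/-! ### Best response to a hitting time and the forward algorithm. -/

instance : Nonempty M.StoppingTime := ⟨⟨M.hit ∅, M.isStoppingTime_hit ∅⟩⟩

theorem valueAgainst_le_of_supersolution (hβ : 0 < β) (hψ : ∀ x, 0 ≤ ψ x) (hφ : ∀ x, 0 ≤ φ x)
    {S : Set E} {v : E → ℝ} (hψv : ∀ x, ψ x ≤ v x) (hφv : ∀ x ∈ S, φ x ≤ v x)
    (hv : ∀ x ∉ S, discountedGenerator Q β v x ≤ 0) (x : E) :
    M.valueAgainst β ψ φ S x ≤ v x :=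
  ciSup_le fun τ => M.payoff_le_of_supersolution hβ hψ hφ hψv hφv hv τ x

/-- If the payoff of two hitting times is a supersolution dominating the obstacles, then it is the
best payoff. -/
theorem valueAgainst_eq_payoff_hit (hβ : 0 < β) (hψ : ∀ x, 0 ≤ ψ x) (hφ : ∀ x, 0 ≤ φ x)
    {S D : Set E} (hψv : ∀ x, ψ x ≤ M.payoff β ψ φ (M.hit D) (M.hit S) x)
    (hφv : ∀ x ∈ S, φ x ≤ M.payoff β ψ φ (M.hit D) (M.hit S) x)
    (hv : ∀ x ∉ S, discountedGenerator Q β (M.payoff β ψ φ (M.hit D) (M.hit S)) x ≤ 0) :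
    M.valueAgainst β ψ φ S = M.payoff β ψ φ (M.hit D) (M.hit S) := by
  ext x
  refine le_antisymm (M.valueAgainst_le_of_supersolution hβ hψ hφ hψv hφv hv x) ?_
  refine le_ciSup (f := fun τ : M.StoppingTime => M.payoff β ψ φ τ.1 (M.hit S) x)
    ⟨_, Set.forall_mem_range.2 fun τ => M.payoff_le_of_supersolution hβ hψ hφ hψv hφv hv τ x⟩
    ⟨M.hit D, M.isStoppingTime_hit D⟩

/-- The empty set is never hit, so `V₀` is covered by the results on `valueAgainst`. -/
lemma onePlayerValue_eq_valueAgainst_empty (β : ℝ) (ψ φ : E → ℝ) :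
    M.onePlayerValue β ψ = M.valueAgainst β ψ φ ∅ := by
  ext x
  simp [onePlayerValue, valueAgainst, payoff, hit]

lemma forwardSet_antitone (β : ℝ) (ψ φ : E → ℝ) (S : Set E) :
    Antitone (M.forwardSet β ψ φ S) :=
  antitone_nat_of_succ_le fun _ => Set.inter_subset_right

lemma disjoint_forwardSet (β : ℝ) (ψ φ : E → ℝ) (S : Set E) (n : ℕ) :
    Disjoint (M.forwardSet β ψ φ S n) S :=
  Set.disjoint_left.2 fun _ hx => (M.forwardSet_antitone β ψ φ S (Nat.zero_le n) hx).2

/-- A subsolution off `A ∪ S` which lies below the boundary data lies below the payoff of the two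
hitting times, strictly so where it is a strict subsolution. -/
lemma le_payoff_hit_hit (hβ : 0 < β) {A S : Set E} (hAS : Disjoint A S) {u : E → ℝ}
    (hA : ∀ x ∈ A, u x ≤ ψ x) (hS : ∀ x ∈ S, u x ≤ φ x)
    (hu : ∀ x ∉ A ∪ S, 0 ≤ discountedGenerator Q β u x) :
    (∀ x, u x ≤ M.payoff β ψ φ (M.hit A) (M.hit S) x) ∧
    ∀ x ∉ A ∪ S, 0 < discountedGenerator Q β u x →
      u x < M.payoff β ψ φ (M.hit A) (M.hit S) x := by
  obtain ⟨h1, h2, h3⟩ := M.payoff_hit_hit_spec hβ ψ φ hAS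
  set p := M.payoff β ψ φ (M.hit A) (M.hit S)
  have h : ∀ x, 0 ≤ (p - u) x := by
    refine M.isGenerator.nonneg_of_supersolution hβ (B := A ∪ S) ?_ fun x hx => ?_
    · rintro x (hx | hx)
      · simpa [h1 x hx] using hA x hx
      · simpa [h2 x hx] using hS x hx
    · rw [discountedGenerator_sub, h3 x hx]
      linarith [hu x hx]
  refine ⟨fun x => sub_nonneg.1 (h x), fun x hx hpos => sub_pos.1 ?_⟩
  refine M.isGenerator.pos_of_strict_supersolution (β := β) h ?_
  rw [discountedGenerator_sub, h3 x hx]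
  linarith

/-- Along the forward algorithm the payoff dominates `ψ`, strictly off the stopping sets. -/
lemma lt_payoff_forwardSet (hβ : 0 < β) (hψφ : ∀ x, ψ x ≤ φ x) (S : Set E) (n : ℕ) :
    ∀ x ∉ M.forwardSet β ψ φ S n ∪ S,
      ψ x < M.payoff β ψ φ (M.hit (M.forwardSet β ψ φ S n)) (M.hit S) x := by
  induction n with
  | zero =>
    have hpos : ∀ x ∉ M.forwardSet β ψ φ S 0 ∪ S, 0 < discountedGenerator Q β ψ x := by
      intro x hx
      by_contra! hle
      exact hx (by by_cases hS : x ∈ S; exacts [Or.inr hS, Or.inl ⟨hle, hS⟩])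
    exact fun x hx => (M.le_payoff_hit_hit hβ (M.disjoint_forwardSet β ψ φ S 0)
      (fun _ _ => le_rfl) (fun x _ => hψφ x) (fun x hx => (hpos x hx).le)).2 x hx (hpos x hx)
  | succ n ih =>
    obtain ⟨h1, h2, h3⟩ := M.payoff_hit_hit_spec hβ ψ φ (M.disjoint_forwardSet β ψ φ S n)
    have hcases : ∀ x ∉ M.forwardSet β ψ φ S (n + 1) ∪ S,
        (x ∉ M.forwardSet β ψ φ S n ∪ S) ∨ (x ∈ M.forwardSet β ψ φ S n ∧
          0 < discountedGenerator Q β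
            (M.payoff β ψ φ (M.hit (M.forwardSet β ψ φ S n)) (M.hit S)) x) := by
      intro x hx
      by_cases hx' : x ∈ M.forwardSet β ψ φ S n
      · refine Or.inr ⟨hx', ?_⟩
        by_contra! hle
        exact hx (Or.inl ⟨hle, hx'⟩)
      · exact Or.inl fun h => h.elim hx' fun hS => hx (Or.inr hS)
    -- The old payoff is a subsolution off the new stopping sets: harmonic where it was so before,
    -- strict at the discarded points. So the new payoff dominates it, strictly at those points.
    obtain ⟨hle, hlt⟩ := M.le_payoff_hit_hit (ψ := ψ) (φ := φ) hβ
      (M.disjoint_forwardSet β ψ φ S (n + 1))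
      (u := M.payoff β ψ φ (M.hit (M.forwardSet β ψ φ S n)) (M.hit S))
      (fun x hx => (h1 x hx.2).le) (fun x hx => (h2 x hx).le) (fun x hx =>
        (hcases x hx).elim (fun h => (h3 x h).ge) fun h => h.2.le)
    intro x hx
    rcases hcases x hx with h | ⟨h, hpos⟩
    · exact (ih x h).trans_le (hle x)
    · exact (h1 x h).symm.trans_lt (hlt x hx hpos)

/-- A decreasing sequence of subsets of a finite set is eventually constant. The repeated step is
recorded because it yields the sign of the generator on the limit. -/
lemma exists_forwardLimit_eq (β : ℝ) (ψ φ : E → ℝ) (S : Set E) :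
    ∃ n, M.forwardLimit β ψ φ S = M.forwardSet β ψ φ S n ∧
      M.forwardSet β ψ φ S (n + 1) = M.forwardSet β ψ φ S n := by
  obtain ⟨n, hn⟩ := WellFoundedGT.monotone_chain_condition (α := (Set E)ᵒᵈ)
    ⟨fun n => OrderDual.toDual (M.forwardSet β ψ φ S n), fun _ _ h =>
      M.forwardSet_antitone β ψ φ S h⟩
  replace hn : ∀ m, n ≤ m → M.forwardSet β ψ φ S n = M.forwardSet β ψ φ S m := hn
  refine ⟨n, subset_antisymm (Set.iInter_subset _ n) (Set.subset_iInter fun m => ?_),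
    (hn _ n.le_succ).symm⟩
  rcases le_total n m with h | h
  · exact (hn m h).subset
  · exact M.forwardSet_antitone β ψ φ S h

/-- Correctness of the forward algorithm: its output is an optimal stopping set against the
hitting time of `S`. -/
theorem forwardLimit_spec (hβ : 0 < β) (hψ : ∀ x, 0 ≤ ψ x) (hψφ : ∀ x, ψ x ≤ φ x) (S : Set E) :
    M.valueAgainst β ψ φ S = M.payoff β ψ φ (M.hit (M.forwardLimit β ψ φ S)) (M.hit S) ∧
    Disjoint (M.forwardLimit β ψ φ S) S ∧
    (∀ x ∈ M.forwardLimit β ψ φ S, M.valueAgainst β ψ φ S x = ψ x) ∧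
    (∀ x ∈ S, M.valueAgainst β ψ φ S x = φ x) ∧
    (∀ x ∉ M.forwardLimit β ψ φ S ∪ S, ψ x < M.valueAgainst β ψ φ S x) ∧
    (∀ x ∈ M.forwardLimit β ψ φ S,
      discountedGenerator Q β (M.valueAgainst β ψ φ S) x ≤ 0) ∧
    ∀ x ∉ M.forwardLimit β ψ φ S ∪ S,
      discountedGenerator Q β (M.valueAgainst β ψ φ S) x = 0 := by
  obtain ⟨n, hn, hstab⟩ := M.exists_forwardLimit_eq β ψ φ S
  rw [hn]
  have hdisj := M.disjoint_forwardSet β ψ φ S n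
  obtain ⟨h1, h2, h3⟩ := M.payoff_hit_hit_spec hβ ψ φ hdisj
  have hlt := M.lt_payoff_forwardSet hβ hψφ S n
  have hD : ∀ x ∈ M.forwardSet β ψ φ S n, discountedGenerator Q β
      (M.payoff β ψ φ (M.hit (M.forwardSet β ψ φ S n)) (M.hit S)) x ≤ 0 := fun x hx => by
    rw [← hstab] at hx
    exact hx.1
  have hval : M.valueAgainst β ψ φ S =
      M.payoff β ψ φ (M.hit (M.forwardSet β ψ φ S n)) (M.hit S) := by
    refine M.valueAgainst_eq_payoff_hit hβ hψ (fun x => (hψ x).trans (hψφ x)) (fun x => ?_)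
      (fun x hx => (h2 x hx).ge) fun x hx => ?_
    · by_cases hS : x ∈ S
      · exact (hψφ x).trans (h2 x hS).ge
      by_cases hx : x ∈ M.forwardSet β ψ φ S n
      · exact (h1 x hx).ge
      · exact (hlt x fun h => h.elim hx hS).le
    · by_cases hx' : x ∈ M.forwardSet β ψ φ S n
      · exact hD x hx'
      · exact (h3 x fun h => h.elim hx' hx).le
  rw [hval]
  exact ⟨rfl, hdisj, h1, h2, hlt, hD, h3⟩

lemma le_valueAgainst (hβ : 0 < β) (hψ : ∀ x, 0 ≤ ψ x) (hψφ : ∀ x, ψ x ≤ φ x) (S : Set E)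
    (x : E) : ψ x ≤ M.valueAgainst β ψ φ S x := by
  obtain ⟨-, -, h1, h2, h3, -, -⟩ := M.forwardLimit_spec hβ hψ hψφ S
  by_cases hS : x ∈ S
  · exact (hψφ x).trans (h2 x hS).ge
  by_cases hx : x ∈ M.forwardLimit β ψ φ S
  · exact (h1 x hx).ge
  · exact (h3 x fun h => h.elim hx hS).le

lemma discountedGenerator_valueAgainst_nonpos (hβ : 0 < β) (hψ : ∀ x, 0 ≤ ψ x)
    (hψφ : ∀ x, ψ x ≤ φ x) {S : Set E} {x : E} (hx : x ∉ S) :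
    discountedGenerator Q β (M.valueAgainst β ψ φ S) x ≤ 0 := by
  obtain ⟨-, -, -, -, -, h1, h2⟩ := M.forwardLimit_spec hβ hψ hψφ S
  by_cases hx' : x ∈ M.forwardLimit β ψ φ S
  · exact h1 x hx'
  · exact (h2 x fun h => h.elim hx' hx).le

/-! ### Monotonicity along the recursion in `k`. -/

lemma setOf_eq_subset_infSet (β : ℝ) (ψ φ : E → ℝ) (k : ℕ) :
    {x | φ x = ψ x} ⊆ M.infSet β ψ φ k := by
  cases k <;> exact Set.subset_union_right

lemma infSet_antitone (β : ℝ) (ψ φ : E → ℝ) : Antitone (M.infSet β ψ φ) :=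
  antitone_nat_of_succ_le fun k =>
    Set.union_subset Set.inter_subset_left (M.setOf_eq_subset_infSet β ψ φ k)

lemma value_succ_le (hβ : 0 < β) (hψ : ∀ x, 0 ≤ ψ x) (hψφ : ∀ x, ψ x ≤ φ x) (k : ℕ) (x : E) :
    M.value β ψ φ (k + 1) x ≤ M.value β ψ φ k x := by
  refine M.valueAgainst_le_of_supersolution hβ hψ (fun x => (hψ x).trans (hψφ x))
    (M.le_valueAgainst hβ hψ hψφ _) (fun x hx => ?_) (fun x hx => ?_) x
  · exact ((M.forwardLimit_spec hβ hψ hψφ _).2.2.2.1 x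
      (M.infSet_antitone β ψ φ k.le_succ hx)).ge
  · by_cases hx' : x ∈ M.infSet β ψ φ k
    · by_contra! hpos
      exact hx (Or.inl ⟨hx', hpos.le⟩)
    · exact M.discountedGenerator_valueAgainst_nonpos hβ hψ hψφ hx'

/-- `V₀` is a supersolution everywhere and dominates `ψ`; the choice of `S₁` makes it dominate `φ`
there. -/
lemma value_zero_le_onePlayerValue (hβ : 0 < β) (hψ : ∀ x, 0 ≤ ψ x) (hψφ : ∀ x, ψ x ≤ φ x)
    (x : E) : M.value β ψ φ 0 x ≤ M.onePlayerValue β ψ x := by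
  have hV : ∀ x, ψ x ≤ M.onePlayerValue β ψ x := fun x => by
    rw [M.onePlayerValue_eq_valueAgainst_empty β ψ φ]
    exact M.le_valueAgainst hβ hψ hψφ ∅ x
  refine M.valueAgainst_le_of_supersolution hβ hψ (fun x => (hψ x).trans (hψφ x)) hV ?_
    (fun x _ => ?_) x
  · rintro x (hx | hx)
    · exact le_of_lt hx
    · exact (le_of_eq hx).trans (hV x)
  · rw [M.onePlayerValue_eq_valueAgainst_empty β ψ φ]
    exact M.discountedGenerator_valueAgainst_nonpos hβ hψ hψφ (Set.notMem_empty x)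

lemma value_le (hβ : 0 < β) (hψ : ∀ x, 0 ≤ ψ x) (hψφ : ∀ x, ψ x ≤ φ x) (k : ℕ) (x : E) :
    M.value β ψ φ k x ≤ φ x := by
  induction k with
  | zero =>
    by_cases hx : x ∈ M.infSet β ψ φ 0
    · exact ((M.forwardLimit_spec hβ hψ hψφ _).2.2.2.1 x hx).le
    · refine (M.value_zero_le_onePlayerValue hβ hψ hψφ x).trans ?_
      by_contra! h
      exact hx (Or.inl h)
  | succ k ih => exact (M.value_succ_le hβ hψ hψφ k x).trans ih

/-- On `D_k` the next value is at most `V_k = ψ`, whereas it would exceed `ψ` off `D_{k+1} ∪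
S_{k+1}`. -/
lemma supSet_monotone (hβ : 0 < β) (hψ : ∀ x, 0 ≤ ψ x) (hψφ : ∀ x, ψ x ≤ φ x) :
    Monotone (M.supSet β ψ φ) := by
  refine monotone_nat_of_le_succ fun k x hx => ?_
  obtain ⟨-, hdisj, hψk, -⟩ := M.forwardLimit_spec hβ hψ hψφ (M.infSet β ψ φ k)
  obtain ⟨-, -, -, -, hlt, -⟩ := M.forwardLimit_spec hβ hψ hψφ (M.infSet β ψ φ (k + 1))
  by_contra hx'
  have hS : x ∉ M.infSet β ψ φ (k + 1) := fun h =>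
    Set.disjoint_left.1 hdisj hx (M.infSet_antitone β ψ φ k.le_succ h)
  refine (hlt x fun h => h.elim hx' hS).not_ge ?_
  exact (M.value_succ_le hβ hψ hψφ k x).trans (hψk x hx).le

end FiniteMarkovChain

end

theorem theorem3p6 {E : Type*} [Fintype E] [TopologicalSpace E] [DiscreteTopology E]
    [MeasurableSpace E] [BorelSpace E] {Ω : Type*} [MeasurableSpace Ω]
    {Q : Matrix E E ℝ} (M : FiniteMarkovChain Q Ω)
    (β : ℝ) (hβ : 0 < β) (ψ φ : E → ℝ) (hψ : ∀ x, 0 ≤ ψ x) (hψφ : ∀ x, ψ x ≤ φ x) :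
    (∀ k : ℕ,
      -- (i)
      (∀ x, M.value β ψ φ k x =
        M.payoff β ψ φ (M.hit (M.supSet β ψ φ k)) (M.hit (M.infSet β ψ φ k)) x) ∧
      -- (ii)
      Disjoint (M.supSet β ψ φ k) (M.infSet β ψ φ k) ∧
      (∀ x ∈ M.supSet β ψ φ k, M.value β ψ φ k x = ψ x) ∧
      (∀ x ∈ M.infSet β ψ φ k, M.value β ψ φ k x = φ x) ∧
      (∀ x, x ∉ M.supSet β ψ φ k ∪ M.infSet β ψ φ k → ψ x < M.value β ψ φ k x) ∧
      -- (iii)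
      (∀ x ∈ M.supSet β ψ φ k, discountedGenerator Q β (M.value β ψ φ k) x ≤ 0) ∧
      (∀ x, x ∉ M.supSet β ψ φ k ∪ M.infSet β ψ φ k →
        discountedGenerator Q β (M.value β ψ φ k) x = 0) ∧
      -- (iv)
      (∀ x, ψ x ≤ M.value β ψ φ (k + 1) x ∧
        M.value β ψ φ (k + 1) x ≤ M.value β ψ φ k x ∧ M.value β ψ φ k x ≤ φ x)) ∧
    -- (v)
    Monotone (M.supSet β ψ φ) ∧ Antitone (M.infSet β ψ φ) := by
  refine ⟨fun k => ?_, M.supSet_monotone hβ hψ hψφ, M.infSet_antitone β ψ φ⟩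
  obtain ⟨h1, h2, h3, h4, h5, h6, h7⟩ := M.forwardLimit_spec hβ hψ hψφ (M.infSet β ψ φ k)
  exact ⟨congrFun h1, h2, h3, h4, h5, h6, h7, fun x => ⟨M.le_valueAgainst hβ hψ hψφ _ x,
    M.value_succ_le hβ hψ hψφ k x, M.value_le hβ hψ hψφ k x⟩⟩
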